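/- Let $\Sigma=\{z\in\mathbb C:\ 0\le \operatorname{Im} z\le\pi\}$ and let $C_b(\Sigma)$ be the space of bounded continuous functions $f:\Sigma\to\mathbb C$ with the norm $\|f\|=\sup_{z\in\Sigma}|f(z)|$. Let $APH(\Sigma)\subset C_b(\Sigma)$ be the Banach space (with the same norm) of all $f\in C_b(\Sigma)$ that are holomorphic in the interior of $\Sigma$ and whose family of shifts $\{S_xf\}_{x\in\mathbb R}$, $(S_xf)(z)=f(z+x)$, is relatively compact in $C_b(\Sigma)$. Then $APH(\Sigma)$ has the metric approximation property: for every compact set $K\subset APH(\Sigma)$ and every $\varepsilon>0$ there is a bounded linear operator $T:APH(\Sigma)\to APH(\Sigma)$ of finite rank with $\|T\|\le 1$ such that $\|Tf-f\|\le\varepsilon$ for every $f\in K$. -/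

import Mathlib

open scoped BoundedContinuousFunction

/-- The closed horizontal strip `{z ∈ ℂ : 0 ≤ Im z ≤ π}`. -/
def closedStrip : Set ℂ := {z : ℂ | 0 ≤ z.im ∧ z.im ≤ Real.pi}

/-- The horizontal translation `z ↦ z + x` of the strip by a real number `x`. -/
def stripTranslate (x : ℝ) : C(closedStrip, closedStrip) where
  toFun z := ⟨(z : ℂ) + (x : ℂ), by
    have hz := z.2
    simpa [closedStrip] using hz⟩
  continuous_toFun := by fun_prop

/-- The shift `(S_x f)(z) = f (z + x)`, as an operator on the bounded continuous functions on the
strip (with the sup-norm). -/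
noncomputable def stripShift (x : ℝ) (f : closedStrip →ᵇ ℂ) : closedStrip →ᵇ ℂ :=
  f.compContinuous (stripTranslate x)

/-- A bounded continuous function on the strip is holomorphic in the interior of the strip. (The
function is extended by `0` off the strip; the extension plays no role, since complex
differentiability on the open set `interior closedStrip` only depends on the values there.) -/
def IsHolomorphicInside (f : closedStrip →ᵇ ℂ) : Prop :=
  DifferentiableOn ℂ (Function.extend (Subtype.val : closedStrip → ℂ) (⇑f) 0)
    (interior closedStrip)

/-- Holomorphic almost periodic functions on the strip: bounded continuous on the strip,
holomorphic in its interior, with a family of real shifts that is relatively compact in the space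
of bounded continuous functions with the sup-norm. -/
def IsHolomorphicAlmostPeriodic (f : closedStrip →ᵇ ℂ) : Prop :=
  IsHolomorphicInside f ∧ IsCompact (closure (Set.range fun x : ℝ => stripShift x f))

theorem extend_strip_apply (f : closedStrip → ℂ) {z : ℂ} (hz : z ∈ closedStrip) :
    Function.extend (Subtype.val : closedStrip → ℂ) f 0 z = f ⟨z, hz⟩ :=
  Subtype.val_injective.extend_apply f 0 ⟨z, hz⟩

theorem dist_stripShift_le (x : ℝ) (f g : closedStrip →ᵇ ℂ) :
    dist (stripShift x f) (stripShift x g) ≤ dist f g :=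
  (BoundedContinuousFunction.dist_le dist_nonneg).2
    fun z => BoundedContinuousFunction.dist_coe_le_dist (stripTranslate x z)

/-- The space `APH` of scalar holomorphic almost periodic functions on the strip, as a complex
subspace of the bounded continuous functions; it carries the sup-norm. -/
noncomputable def APH : Submodule ℂ (closedStrip →ᵇ ℂ) where
  carrier := {f | IsHolomorphicAlmostPeriodic f}
  zero_mem' := by
    refine ⟨(differentiableOn_const (0 : ℂ)).congr fun z hz => ?_, ?_⟩
    · rw [extend_strip_apply _ (interior_subset hz)]; rfl
    · refine IsCompact.closure_of_subset (isCompact_singleton (x := (0 : closedStrip →ᵇ ℂ))) ?_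
      rintro _ ⟨x, rfl⟩
      rfl
  add_mem' := by
    rintro f g ⟨hf, hf'⟩ ⟨hg, hg'⟩
    refine ⟨(DifferentiableOn.add hf hg).congr fun z hz => ?_, ?_⟩
    · rw [Pi.add_apply]
      simp only [extend_strip_apply _ (interior_subset hz)]; rfl
    · refine (hf'.add hg').closure_of_subset ?_
      rintro _ ⟨x, rfl⟩
      exact ⟨_, subset_closure ⟨x, rfl⟩, _, subset_closure ⟨x, rfl⟩, rfl⟩
  smul_mem' := by
    rintro c f ⟨hf, hf'⟩
    refine ⟨(DifferentiableOn.const_smul hf c).congr fun z hz => ?_, ?_⟩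
    · rw [Pi.smul_apply]
      simp only [extend_strip_apply _ (interior_subset hz)]; rfl
    · refine (hf'.image (continuous_const_smul c)).closure_of_subset ?_
      rintro _ ⟨x, rfl⟩
      exact ⟨_, subset_closure ⟨x, rfl⟩, rfl⟩

theorem mem_APH_iff (f : closedStrip →ᵇ ℂ) : f ∈ APH ↔ IsHolomorphicAlmostPeriodic f := Iff.rfl

theorem isClosed_APH : IsClosed (APH : Set (closedStrip →ᵇ ℂ)) := by
  refine isClosed_of_closure_subset fun f hf => ?_
  obtain ⟨u, hu, hlim⟩ := mem_closure_iff_seq_limit.1 hf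
  have hunif := BoundedContinuousFunction.tendsto_iff_tendstoUniformly.1 hlim
  refine ⟨?_, ?_⟩
  · refine TendstoLocallyUniformlyOn.differentiableOn
      (F := fun n => Function.extend (Subtype.val : closedStrip → ℂ) (⇑(u n)) 0)
      (φ := Filter.atTop) (TendstoUniformlyOn.tendstoLocallyUniformlyOn ?_)
      (Filter.Eventually.of_forall fun n => (hu n).1) isOpen_interior
    rw [Metric.tendstoUniformlyOn_iff]
    intro ε hε
    filter_upwards [Metric.tendstoUniformly_iff.1 hunif ε hε] with n hn z hz
    rw [extend_strip_apply _ (interior_subset hz), extend_strip_apply _ (interior_subset hz)]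
    exact hn ⟨z, interior_subset hz⟩
  · refine TotallyBounded.isCompact_of_isClosed (TotallyBounded.closure ?_) isClosed_closure
    rw [Metric.totallyBounded_iff]
    intro ε hε
    obtain ⟨n, hn⟩ := ((Metric.tendsto_nhds.1 hlim) (ε / 2) (half_pos hε)).exists
    obtain ⟨t, ht, hcov⟩ := Metric.totallyBounded_iff.1
      ((hu n).2.totallyBounded.subset subset_closure) (ε / 2) (half_pos hε)
    refine ⟨t, ht, ?_⟩
    rintro _ ⟨x, rfl⟩
    obtain ⟨y, hy, hxy⟩ := Set.mem_iUnion₂.1 (hcov ⟨x, rfl⟩)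
    refine Set.mem_iUnion₂.2 ⟨y, hy, ?_⟩
    rw [Metric.mem_ball] at hxy ⊢
    have h1 := dist_triangle (stripShift x f) (stripShift x (u n)) y
    have h2 := dist_stripShift_le x f (u n)
    rw [dist_comm] at hn
    dsimp only at hxy ⊢
    linarith

/-- `APH` is a Banach space. -/
instance instCompleteSpaceAPH : CompleteSpace APH := isClosed_APH.completeSpace_coe

/-- A complex Banach space `X` has the metric approximation property: for every compact `K ⊆ X`
and every `ε > 0` there is a bounded operator `T` on `X` of finite rank and of norm at most one
with `‖T x - x‖ ≤ ε` for all `x ∈ K`. -/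
def HasMetricApproximationProperty (X : Type*) [NormedAddCommGroup X] [NormedSpace ℂ X]
    [CompleteSpace X] : Prop :=
  ∀ K : Set X, IsCompact K → ∀ ε : ℝ, 0 < ε →
    ∃ T : X →L[ℂ] X, FiniteDimensional ℂ (LinearMap.range (T : X →ₗ[ℂ] X)) ∧ ‖T‖ ≤ 1 ∧
      ∀ x ∈ K, ‖T x - x‖ ≤ ε

/-! The approximants are convolutions `z ↦ Q⁻¹ ∫₀ᴸ f(t) H(z - t) dt` with a kernel `H ∈ APH` that is
nonnegative on `ℝ` and concentrated at almost periods of the given finite family.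

The difficulty is the norm. On the lower edge `H(x - t) ≥ 0`, so the convolution is essentially an
average of `f`. On the upper edge the kernel takes uncontrolled complex values. Since the integrand
is holomorphic, Cauchy's theorem moves the contour up by `πi` (`norm_integral_convolution_sub_le`),
turning the integral into an average of `f(t + πi)` against the same `H(x - t) ≥ 0`. The vertical
sides cost `2π‖f‖‖H‖`, independent of `L`, hence negligible against the mass of order `L`. The
maximum principle carries both edge bounds into the strip.

For the kernel (`AlmostPeriodicGauge.exists_kernel`), let `φ(t)` be the largest displacement of the
family under the shift by `t`. The bump `max 0 (ε - φ)` is almost periodic with positive mean;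
convolving it with a narrow Gaussian makes it entire and keeps these properties. Discretizing the
kernel, but not `f`, gives finite rank with an error uniform on bounded sets of `f`
(`exists_finiteRank_approx_convolution`). -/

open MeasureTheory Filter Topology Set

/-! ### Boundary values, maximum principle and contour shift -/

/-- The extension by `0` to the plane of a function on the strip. -/
noncomputable def stripExtend (f : closedStrip →ᵇ ℂ) : ℂ → ℂ :=
  Function.extend (Subtype.val : closedStrip → ℂ) f 0

theorem mem_closedStrip {z : ℂ} : z ∈ closedStrip ↔ 0 ≤ z.im ∧ z.im ≤ Real.pi := Iff.rfl

theorem stripExtend_apply (f : closedStrip →ᵇ ℂ) {z : ℂ} (hz : z ∈ closedStrip) :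
    stripExtend f z = f ⟨z, hz⟩ := extend_strip_apply f hz

theorem norm_stripExtend_le (f : closedStrip →ᵇ ℂ) (z : ℂ) : ‖stripExtend f z‖ ≤ ‖f‖ := by
  by_cases hz : z ∈ closedStrip
  · rw [stripExtend_apply f hz]; exact f.norm_coe_le_norm _
  · rw [stripExtend, Function.extend_apply' _ _ _ (by simpa using hz)]; simp

theorem add_ofReal_mem_closedStrip {z : ℂ} (hz : z ∈ closedStrip) (x : ℝ) :
    z + x ∈ closedStrip := by simpa [mem_closedStrip] using hz

theorem sub_ofReal_mem_closedStrip {z : ℂ} (hz : z ∈ closedStrip) (x : ℝ) :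
    z - x ∈ closedStrip := by simpa [mem_closedStrip] using hz

theorem ofReal_mem_closedStrip (x : ℝ) : (x : ℂ) ∈ closedStrip := by
  simp [mem_closedStrip, Real.pi_pos.le]

theorem ofReal_add_pi_mem_closedStrip (x : ℝ) : (x : ℂ) + Real.pi * Complex.I ∈ closedStrip := by
  simp [mem_closedStrip, Real.pi_pos.le]

theorem stripExtend_stripShift (x : ℝ) (f : closedStrip →ᵇ ℂ) {z : ℂ} (hz : z ∈ closedStrip) :
    stripExtend (stripShift x f) z = stripExtend f (z + x) := by
  rw [stripExtend_apply _ hz, stripExtend_apply _ (add_ofReal_mem_closedStrip hz x)]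
  rfl

theorem stripExtend_sub (f g : closedStrip →ᵇ ℂ) {z : ℂ} (hz : z ∈ closedStrip) :
    stripExtend (f - g) z = stripExtend f z - stripExtend g z := by
  simp [stripExtend_apply _ hz]

theorem norm_stripExtend_add_sub_le (f : closedStrip →ᵇ ℂ) (x : ℝ) {z : ℂ}
    (hz : z ∈ closedStrip) :
    ‖stripExtend f (z + x) - stripExtend f z‖ ≤ dist (stripShift x f) f := by
  rw [← stripExtend_stripShift x f hz, ← stripExtend_sub _ _ hz, dist_eq_norm]
  exact norm_stripExtend_le _ _

theorem continuousOn_stripExtend (f : closedStrip →ᵇ ℂ) :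
    ContinuousOn (stripExtend f) closedStrip := by
  rw [continuousOn_iff_continuous_domRestrict]
  convert f.continuous using 1
  ext z
  exact stripExtend_apply f z.2

theorem interior_closedStrip : interior closedStrip = Complex.im ⁻¹' Ioo 0 Real.pi := by
  rw [← interior_Icc, ← Complex.interior_preimage_im]; rfl

theorem closure_im_preimage_Ioo_pi :
    closure (Complex.im ⁻¹' Ioo 0 Real.pi) = closedStrip := by
  rw [Complex.closure_preimage_im, closure_Ioo Real.pi_pos.ne]; rfl

/-- The maximum principle on the strip. -/
theorem norm_le_of_boundary_le {f : closedStrip →ᵇ ℂ} (hf : IsHolomorphicInside f) {C : ℝ}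
    (h0 : ∀ x : ℝ, ‖stripExtend f x‖ ≤ C)
    (h1 : ∀ x : ℝ, ‖stripExtend f (x + Real.pi * Complex.I)‖ ≤ C) : ‖f‖ ≤ C := by
  refine (BoundedContinuousFunction.norm_le ((norm_nonneg _).trans (h0 0))).2 fun z => ?_
  rw [← stripExtend_apply f z.2]
  -- Boundedness is the growth condition with both exponents equal to `0`.
  refine PhragmenLindelof.horizontal_strip (a := 0) (b := Real.pi) ⟨?_, ?_⟩ ⟨0, ?_, 0, ?_⟩
    (fun w hw => ?_) (fun w hw => ?_) z.2.1 z.2.2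
  · rw [← interior_closedStrip]; exact hf
  · rw [closure_im_preimage_Ioo_pi]; exact continuousOn_stripExtend f
  · rw [sub_zero, div_self Real.pi_ne_zero]; exact one_pos
  · refine Asymptotics.IsBigO.of_bound ‖f‖ (Eventually.of_forall fun w => ?_)
    simpa using norm_stripExtend_le f w
  · rw [show w = w.re by apply Complex.ext <;> simp [hw]]
    exact h0 w.re
  · rw [show w = w.re + Real.pi * Complex.I by apply Complex.ext <;> simp [hw]]
    exact h1 w.re

theorem continuous_stripExtend_comp {f : closedStrip →ᵇ ℂ} {γ : ℝ → ℂ} (hγ : Continuous γ)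
    (hmem : ∀ t, γ t ∈ closedStrip) : Continuous fun t => stripExtend f (γ t) :=
  (continuousOn_stripExtend f).comp_continuous hγ hmem

/-- Moving the contour of a convolution from the lower to the upper boundary of the strip. -/
theorem norm_integral_convolution_sub_le {f g : closedStrip →ᵇ ℂ} (hf : IsHolomorphicInside f)
    (hg : IsHolomorphicInside g) (x L : ℝ) :
    ‖(∫ t in (0 : ℝ)..L, stripExtend f t * stripExtend g (x + Real.pi * Complex.I - t)) -
      ∫ t in (0 : ℝ)..L, stripExtend f (t + Real.pi * Complex.I) * stripExtend g (x - t : ℝ)‖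
      ≤ 2 * Real.pi * (‖f‖ * ‖g‖) := by
  set c : ℂ := x + Real.pi * Complex.I with hc
  set G : ℂ → ℂ := fun w => stripExtend f w * stripExtend g (c - w) with hG
  -- Since `Im c = π`, the reflection `w ↦ c - w` preserves the strip and swaps its edges.
  have hmaps : MapsTo (fun w => c - w) closedStrip closedStrip := by
    intro w hw
    simp only [mem_closedStrip, hc] at hw ⊢
    constructor <;> simp <;> linarith [hw.1, hw.2]
  have hmaps' : MapsTo (fun w => c - w) (interior closedStrip) (interior closedStrip) := by
    intro w hw
    simp only [interior_closedStrip, mem_preimage, mem_Ioo, hc] at hw ⊢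
    constructor <;> simp <;> linarith [hw.1, hw.2]
  have hcont : ContinuousOn G closedStrip :=
    (continuousOn_stripExtend f).mul
      ((continuousOn_stripExtend g).comp (by fun_prop) hmaps)
  have hdiff : DifferentiableOn ℂ G (interior closedStrip) :=
    DifferentiableOn.mul hf (DifferentiableOn.comp (t := interior closedStrip) hg
      (by fun_prop) hmaps')
  have key := Complex.integral_boundary_rect_eq_zero_of_continuousOn_of_differentiableOn G 0
    (L + Real.pi * Complex.I) (hcont.mono ?_) (hdiff.mono ?_)
  rotate_left
  · intro w hw
    have := hw.2
    simpa [uIcc_of_le Real.pi_pos.le, mem_closedStrip] using this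
  · intro w hw
    have := hw.2
    rw [interior_closedStrip]
    simpa [Real.pi_pos.le] using this
  have hbound : ∀ w, ‖G w‖ ≤ ‖f‖ * ‖g‖ := fun w => by
    rw [norm_mul]
    gcongr <;> exact norm_stripExtend_le _ _
  have hside : ∀ a : ℂ, ‖Complex.I • ∫ y in (0 : ℝ)..Real.pi, G (a + y * Complex.I)‖
      ≤ ‖f‖ * ‖g‖ * Real.pi := fun a => by
    have := intervalIntegral.norm_integral_le_of_norm_le_const (a := 0) (b := Real.pi)
      (f := fun y : ℝ => G (a + y * Complex.I)) (fun y _ => hbound _)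
    rw [norm_smul, Complex.norm_I, one_mul]
    rwa [sub_zero, abs_of_pos Real.pi_pos] at this
  have h1 := hside (L : ℂ)
  have h2 := hside (0 : ℂ)
  simp only [Complex.zero_re, Complex.zero_im, Complex.add_re, Complex.ofReal_re, Complex.mul_re,
    Complex.I_re, Complex.I_im, Complex.ofReal_im, Complex.add_im, Complex.mul_im, mul_zero,
    mul_one, zero_mul, sub_zero, add_zero, zero_add, Complex.ofReal_zero] at key h1 h2
  have htop : ∀ t : ℝ, G (t + Real.pi * Complex.I) =
      stripExtend f (t + Real.pi * Complex.I) * stripExtend g (x - t : ℝ) := fun t => by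
    simp only [hG, hc, Complex.ofReal_sub]
    congr 2
    ring
  simp only [htop] at key
  have : (∫ t in (0 : ℝ)..L, G t) - ∫ t in (0 : ℝ)..L,
      stripExtend f (t + Real.pi * Complex.I) * stripExtend g (x - t : ℝ) =
      Complex.I • (∫ y in (0 : ℝ)..Real.pi, G (y * Complex.I)) -
        Complex.I • (∫ y in (0 : ℝ)..Real.pi, G (L + y * Complex.I)) := by
    linear_combination key
  rw [this]
  refine (norm_sub_le _ _).trans ?_
  linarith

/-! ### Displacement under shifts as a gauge on the line -/

/-- The shifts of a function with relatively compact orbit depend continuously on the shift. -/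
theorem tendsto_stripShift_zero {f : closedStrip →ᵇ ℂ}
    (hf : IsCompact (closure (range fun x : ℝ => stripShift x f))) :
    Tendsto (fun x : ℝ => stripShift x f) (𝓝 0) (𝓝 f) := by
  -- In a compact set it suffices that `f` is the only cluster point; pointwise continuity of `f`
  -- identifies it.
  refine hf.tendsto_nhds_of_unique_mapClusterPt
    (Eventually.of_forall fun x => subset_closure ⟨x, rfl⟩) fun g _ hg => ?_
  ext z
  have h1 : MapClusterPt (g z) (𝓝 (0 : ℝ)) fun x : ℝ => stripShift x f z :=
    hg.continuousAt_comp
      (BoundedContinuousFunction.lipschitz_eval_const z).continuous.continuousAt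
  have h2 : Tendsto (fun x : ℝ => stripShift x f z) (𝓝 0) (𝓝 (f z)) := by
    have hcont : Continuous fun x : ℝ => stripShift x f z :=
      f.continuous.comp (Continuous.subtype_mk (by fun_prop) _)
    convert hcont.tendsto 0 using 2
    simp [stripShift, stripTranslate]
  have : (𝓝 (g z) ⊓ 𝓝 (f z)).NeBot := h1.clusterPt.mono h2
  exact eq_of_nhds_neBot this

/-- A bounded even subadditive function on the line, small near `0`, for which the line is
totally bounded with respect to the pseudometric `φ (x - y)`. -/
structure AlmostPeriodicGauge (φ : ℝ → ℝ) : Prop where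
  zero : φ 0 = 0
  neg : ∀ t, φ (-t) = φ t
  add_le : ∀ s t, φ (s + t) ≤ φ s + φ t
  bounded : ∃ B, ∀ t, φ t ≤ B
  tendsto_zero : Tendsto φ (𝓝 0) (𝓝 0)
  exists_net : ∀ δ > 0, ∃ s : Finset ℝ, ∀ x, ∃ y ∈ s, φ (x - y) < δ

theorem stripShift_zero (f : closedStrip →ᵇ ℂ) : stripShift 0 f = f := by
  ext z
  simp [stripShift, stripTranslate]

theorem stripShift_add (s t : ℝ) (f : closedStrip →ᵇ ℂ) :
    stripShift (s + t) f = stripShift s (stripShift t f) := by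
  ext z
  simp [stripShift, stripTranslate, add_assoc]

/-- The largest displacement of finitely many functions under a shift. -/
noncomputable def shiftDist {ι : Type*} [Fintype ι] (F : ι → closedStrip →ᵇ ℂ) (t : ℝ) : ℝ :=
  dist (fun i => stripShift t (F i)) F

/-- Shifts form a group of contractions, which gives evenness and subadditivity. The product of the
orbit closures is compact, which gives boundedness and finite nets. -/
theorem almostPeriodicGauge_shiftDist {ι : Type*} [Fintype ι] {F : ι → closedStrip →ᵇ ℂ}
    (hF : ∀ i, IsCompact (closure (range fun x : ℝ => stripShift x (F i)))) :
    AlmostPeriodicGauge (shiftDist F) := by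
  have hle : ∀ (x : ℝ) (G H : ι → closedStrip →ᵇ ℂ),
      dist (fun i => stripShift x (G i)) (fun i => stripShift x (H i)) ≤ dist G H :=
    fun x G H => (dist_pi_le_iff dist_nonneg).2 fun i =>
      (dist_stripShift_le x _ _).trans (dist_le_pi_dist G H i)
  have hneg : ∀ t, shiftDist F (-t) ≤ shiftDist F t := fun t => by
    have := hle (-t) F fun i => stripShift t (F i)
    simp only [← stripShift_add, neg_add_cancel, stripShift_zero] at this
    rwa [dist_comm F] at this
  have hcomp := isCompact_univ_pi hF
  have hmem : ∀ x, (fun i => stripShift x (F i)) ∈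
      univ.pi fun i => closure (range fun x : ℝ => stripShift x (F i)) :=
    fun x i _ => subset_closure ⟨x, rfl⟩
  refine ⟨?_, fun t => (hneg t).antisymm ?_, fun s t => ?_, ?_, ?_, fun δ hδ => ?_⟩
  · simp [shiftDist, stripShift_zero]
  · simpa using hneg (-t)
  · have := hle s (fun i => stripShift t (F i)) F
    simp only [← stripShift_add] at this
    refine (dist_triangle _ (fun i => stripShift s (F i)) _).trans ?_
    rw [add_comm]
    exact add_le_add_right this _
  · obtain ⟨C, hC⟩ := Metric.isBounded_iff.1 hcomp.isBounded
    refine ⟨C, fun t => hC (hmem t) ?_⟩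
    simpa [stripShift_zero] using hmem 0
  · have : Tendsto (fun t : ℝ => fun i => stripShift t (F i)) (𝓝 0) (𝓝 F) :=
      tendsto_pi_nhds.2 fun i => tendsto_stripShift_zero (hF i)
    exact tendsto_iff_dist_tendsto_zero.1 this
  · obtain ⟨T, hTsub, hT, hcov⟩ := Metric.finite_approx_of_totallyBounded
      (hcomp.totallyBounded.subset (range_subset_iff.2 hmem)) δ hδ
    obtain ⟨s', -, hfin, himg⟩ := exists_subset_image_finite_and
      (p := fun U => U = T) (s := univ) |>.1 ⟨T, hTsub.trans image_univ.ge, hT, rfl⟩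
    refine ⟨hfin.toFinset, fun x => ?_⟩
    obtain ⟨G, hG, hx⟩ := mem_iUnion₂.1 (hcov ⟨x, rfl⟩)
    rw [← himg] at hG
    obtain ⟨y, hy, rfl⟩ := hG
    refine ⟨y, hfin.mem_toFinset.2 hy, ?_⟩
    -- Shifting back by `y` turns closeness of two orbit points into smallness of the gauge at `x -
    -- y`.
    have := hle (-y) (fun i => stripShift x (F i)) fun i => stripShift y (F i)
    simp only [← stripShift_add, neg_add_cancel, stripShift_zero] at this
    rw [sub_eq_neg_add]
    exact this.trans_lt hx

theorem norm_stripExtend_sub_le_shiftDist {ι : Type*} [Fintype ι] (F : ι → closedStrip →ᵇ ℂ)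
    (i : ι) (t : ℝ) {z : ℂ} (hz : z ∈ closedStrip) :
    ‖stripExtend (F i) (z + t) - stripExtend (F i) z‖ ≤ shiftDist F t :=
  (norm_stripExtend_add_sub_le (F i) t hz).trans
    (dist_le_pi_dist (fun i => stripShift t (F i)) F i)

/-! ### The bump function and its uniform mean -/

/-- The bump function `max 0 (ε - φ)`. -/
def gaugeBump (φ : ℝ → ℝ) (ε t : ℝ) : ℝ := max 0 (ε - φ t)

theorem AlmostPeriodicGauge.nonneg {φ : ℝ → ℝ} (hφ : AlmostPeriodicGauge φ) (t : ℝ) :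
    0 ≤ φ t := by
  have := hφ.add_le t (-t)
  rw [hφ.neg, add_neg_cancel, hφ.zero] at this
  linarith

theorem AlmostPeriodicGauge.abs_sub_le {φ : ℝ → ℝ} (hφ : AlmostPeriodicGauge φ) (a b : ℝ) :
    |φ a - φ b| ≤ φ (a - b) := by
  have h1 := hφ.add_le (a - b) b
  have h2 := hφ.add_le (-(a - b)) a
  rw [hφ.neg] at h2
  rw [sub_add_cancel] at h1
  rw [neg_sub, sub_add_cancel] at h2
  exact abs_sub_le_iff.2 ⟨by linarith, by linarith⟩

theorem AlmostPeriodicGauge.continuous {φ : ℝ → ℝ} (hφ : AlmostPeriodicGauge φ) : Continuous φ := by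
  refine continuous_iff_continuousAt.2 fun a => tendsto_iff_dist_tendsto_zero.2 ?_
  have h : Tendsto (fun b => φ (b - a)) (𝓝 a) (𝓝 0) :=
    hφ.tendsto_zero.comp (by
      exact (continuous_id.sub (continuous_const (y := a))).tendsto' a 0 (by simp))
  exact squeeze_zero (fun _ => dist_nonneg) (fun b => hφ.abs_sub_le b a) h

theorem AlmostPeriodicGauge.gaugeBump_le {φ : ℝ → ℝ} (hφ : AlmostPeriodicGauge φ) {ε : ℝ}
    (hε : 0 ≤ ε) (t : ℝ) : gaugeBump φ ε t ≤ ε :=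
  max_le hε (by linarith [hφ.nonneg t])

theorem AlmostPeriodicGauge.abs_gaugeBump_sub_le {φ : ℝ → ℝ} (hφ : AlmostPeriodicGauge φ)
    (ε a b : ℝ) :
    |gaugeBump φ ε a - gaugeBump φ ε b| ≤ φ (a - b) := by
  refine (abs_max_sub_max_le_max _ _ _ _).trans ?_
  rw [sub_self, abs_zero, sub_sub_sub_cancel_left, abs_sub_comm]
  exact max_le (hφ.nonneg _) (hφ.abs_sub_le a b)

theorem AlmostPeriodicGauge.continuous_gaugeBump {φ : ℝ → ℝ} (hφ : AlmostPeriodicGauge φ)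
    (ε : ℝ) : Continuous (gaugeBump φ ε) :=
  continuous_const.max (continuous_const.sub hφ.continuous)

theorem gaugeBump_nonneg (φ : ℝ → ℝ) (ε t : ℝ) : 0 ≤ gaugeBump φ ε t := le_max_left _ _

/-- At each point either `φ t ≤ ε` or the bump vanishes. -/
theorem gaugeBump_mul_le (φ : ℝ → ℝ) (ε t : ℝ) :
    gaugeBump φ ε t * φ t ≤ ε * gaugeBump φ ε t := by
  rw [mul_comm ε]
  rcases le_total (φ t) ε with h | h
  · exact mul_le_mul_of_nonneg_left h (gaugeBump_nonneg _ _ _)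
  · simp [gaugeBump, h]

/-- The bump function has a uniform mean value, bounded away from `0`. -/
theorem AlmostPeriodicGauge.exists_mean {φ : ℝ → ℝ} (hφ : AlmostPeriodicGauge φ) {ε : ℝ}
    (hε : 0 < ε) : ∃ c > 0, ∀ δ > 0, ∃ L₀ > 0, ∀ L ≥ L₀, ∃ m ≥ c, ∀ x : ℝ,
      |(∫ t in x..x + L, gaugeBump φ ε t) - m * L| ≤ δ * (m * L) := by
  set k := gaugeBump φ ε with hk
  have hkc : Continuous k := hφ.continuous_gaugeBump ε
  have hki : ∀ a b : ℝ, IntervalIntegrable k volume a b := fun a b => hkc.intervalIntegrable a b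
  -- Moving the window by `y` changes the integral by two pieces, each at most `ε * |y|`.
  have hmove : ∀ y L : ℝ, |(∫ t in y..y + L, k t) - ∫ t in (0 : ℝ)..L, k t| ≤ 2 * ε * |y| := by
    intro y L
    have hb : ∀ a b : ℝ, |∫ t in a..b, k t| ≤ ε * |b - a| := fun a b =>
      intervalIntegral.norm_integral_le_of_norm_le_const (C := ε) fun t _ => by
        rw [Real.norm_of_nonneg (gaugeBump_nonneg _ _ _)]
        exact hφ.gaugeBump_le hε.le t
    have h1 := hb L (y + L)
    have h2 := hb 0 y
    rw [intervalIntegral.integral_interval_sub_interval_comm (hki _ _) (hki _ _) (hki _ _),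
      intervalIntegral.integral_symm 0 y]
    rw [add_sub_cancel_right] at h1
    rw [sub_zero] at h2
    rw [intervalIntegral.integral_symm L (y + L), neg_sub_neg]
    refine (abs_sub _ _).trans ?_
    linarith
  obtain ⟨s, hs⟩ := hφ.exists_net (ε / 2) (half_pos hε)
  have hbd : ∀ s : Finset ℝ, ∃ ℓ ≥ 0, ∀ y ∈ s, |y| ≤ ℓ := fun s =>
    ⟨∑ y ∈ s, |y|, Finset.sum_nonneg fun _ _ => abs_nonneg _, fun y hy =>
      Finset.single_le_sum (f := fun y : ℝ => |y|) (fun _ _ => abs_nonneg _) hy⟩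
  obtain ⟨ℓ, hℓ0, hℓ⟩ := hbd s
  have hn : (0 : ℝ) < s.card := by
    obtain ⟨y, hy, -⟩ := hs 0
    exact_mod_cast Finset.card_pos.2 ⟨y, hy⟩
  set n : ℝ := (s.card : ℝ) with hn_def
  -- The translates of `k` by the `n` points of an `ε / 2`-net sum to at least `ε / 2` everywhere,
  -- so one of them already has density about `ε / (2 * n)`.
  have hlow : ∀ L ≥ 0, ε / 2 * L ≤ n * ((∫ t in (0 : ℝ)..L, k t) + 2 * ε * ℓ) := by
    intro L hL
    have hsum : ∀ x, ε / 2 ≤ ∑ y ∈ s, k (x - y) := fun x => by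
      obtain ⟨y, hy, hxy⟩ := hs x
      have h1 : ε / 2 ≤ k (x - y) := le_max_of_le_right (by linarith)
      exact h1.trans (Finset.single_le_sum (f := fun y => k (x - y))
        (fun _ _ => gaugeBump_nonneg _ _ _) hy)
    have h1 : ∫ x in (0 : ℝ)..L, ε / 2 ≤ ∫ x in (0 : ℝ)..L, ∑ y ∈ s, k (x - y) :=
      intervalIntegral.integral_mono_on hL (by simp)
        (Continuous.intervalIntegrable (by fun_prop) _ _) fun x _ => hsum x
    rw [intervalIntegral.integral_const, intervalIntegral.integral_finsetSum fun y _ =>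
      Continuous.intervalIntegrable (by fun_prop) _ _] at h1
    have h2 : ∑ y ∈ s, ∫ x in (0 : ℝ)..L, k (x - y) ≤
        ∑ y ∈ s, ((∫ t in (0 : ℝ)..L, k t) + 2 * ε * ℓ) := by
      refine Finset.sum_le_sum fun y hy => ?_
      rw [intervalIntegral.integral_comp_sub_right, zero_sub, sub_eq_neg_add]
      have h3 := (abs_le.1 (hmove (-y) L)).2
      rw [abs_neg] at h3
      have h4 : 2 * ε * |y| ≤ 2 * ε * ℓ := by gcongr; exact hℓ y hy
      linarith
    rw [Finset.sum_const, nsmul_eq_mul] at h2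
    simp only [sub_zero, smul_eq_mul] at h1
    linarith
  refine ⟨ε / (4 * n), by positivity, fun δ hδ => ?_⟩
  set c := ε / (4 * n) with hc
  have hcpos : 0 < c := by positivity
  obtain ⟨s', hs'⟩ := hφ.exists_net (δ * c / 2) (by positivity)
  obtain ⟨ℓ', hℓ0', hℓ'⟩ := hbd s'
  -- The first term absorbs the loss `2 * ε * ℓ`, halving the density to `c`; the second makes the
  -- cost of moving the window from a net point to `0` at most `δ * c * L / 2`.
  refine ⟨8 * n * ℓ + 4 * ε * ℓ' / (δ * c) + 1, by positivity, fun L hL => ?_⟩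
  have hq : 0 ≤ 4 * ε * ℓ' / (δ * c) := by positivity
  have hq' : 0 ≤ 8 * n * ℓ := by positivity
  have hLpos : 0 < L := by linarith
  -- The average over `[0, L]` serves as `m`; no limit in `L` is needed, only the lower bound `c`
  -- independent of `L`.
  refine ⟨(∫ t in (0 : ℝ)..L, k t) / L, ?_, fun x => ?_⟩
  · rw [ge_iff_le, le_div_iff₀ hLpos, hc, div_mul_eq_mul_div, div_le_iff₀ (by positivity)]
    have h1 := hlow L hLpos.le
    have h2 : ε * (8 * n * ℓ) ≤ ε * L := by gcongr; linarith
    nlinarith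
  · have hm : c * L ≤ ∫ t in (0 : ℝ)..L, k t := by
      rw [hc, div_mul_eq_mul_div, div_le_iff₀ (by positivity)]
      have h1 := hlow L hLpos.le
      have h2 : ε * (8 * n * ℓ) ≤ ε * L := by gcongr; linarith
      nlinarith
    rw [div_mul_cancel₀ _ hLpos.ne']
    obtain ⟨y, hy, hxy⟩ := hs' x
    have h1 : |(∫ t in x..x + L, k t) - ∫ t in y..y + L, k t| ≤ δ * c / 2 * L := by
      have e : ∀ a, ∫ t in a..a + L, k t = ∫ t in (0 : ℝ)..L, k (t + a) := fun a => by
        rw [intervalIntegral.integral_comp_add_right, zero_add, add_comm]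
      rw [e x, e y, ← intervalIntegral.integral_sub
        (Continuous.intervalIntegrable (by fun_prop) _ _)
        (Continuous.intervalIntegrable (by fun_prop) _ _)]
      have := intervalIntegral.norm_integral_le_of_norm_le_const (a := 0) (b := L)
        (f := fun t => k (t + x) - k (t + y)) (C := δ * c / 2) fun t _ => by
          refine (hφ.abs_gaugeBump_sub_le ε _ _).trans ?_
          rw [add_sub_add_left_eq_sub]
          exact hxy.le
      rwa [sub_zero, abs_of_pos hLpos] at this
    have h2 := hmove y L
    have h3 : 2 * ε * |y| ≤ 2 * ε * ℓ' := by gcongr; exact hℓ' y hy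
    have h4 : 4 * ε * ℓ' ≤ L * (δ * c) := (div_le_iff₀ (by positivity)).1 (by linarith)
    have h5 : δ * (c * L) ≤ δ * ∫ t in (0 : ℝ)..L, k t := by gcongr
    have := _root_.abs_sub_le (∫ t in x..x + L, k t) (∫ t in y..y + L, k t) (∫ t in (0 : ℝ)..L, k t)
    linarith

/-! ### Gaussian smoothing -/

/-- The convolution of `k` with the Gaussian `exp (-N z ^ 2)`, as an entire function. -/
noncomputable def gaussConv (N : ℝ) (k : ℝ → ℝ) (z : ℂ) : ℂ :=
  ∫ s : ℝ, (k s : ℂ) * Complex.exp (-N * (z - s) ^ 2)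

theorem norm_cexp_neg_mul_sub_sq (N : ℝ) (z : ℂ) (s : ℝ) :
    ‖Complex.exp (-N * (z - s) ^ 2)‖ =
      Real.exp (N * z.im ^ 2) * Real.exp (-N * (s - z.re) ^ 2) := by
  rw [Complex.norm_exp, ← Real.exp_add]
  congr 1
  simp [sq, Complex.mul_re]
  ring

theorem integrable_exp_neg_mul_sub_sq {N : ℝ} (hN : 0 < N) (a : ℝ) :
    Integrable fun s : ℝ => Real.exp (-N * (s - a) ^ 2) :=
  (integrable_exp_neg_mul_sq hN).comp_sub_right a

theorem integrable_norm_cexp {N : ℝ} (hN : 0 < N) (z : ℂ) :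
    Integrable fun s : ℝ => ‖Complex.exp (-N * (z - s) ^ 2)‖ := by
  simp only [norm_cexp_neg_mul_sub_sq]
  exact (integrable_exp_neg_mul_sub_sq hN _).const_mul _

theorem integrable_mul_cexp {N M : ℝ} (hN : 0 < N) {k : ℝ → ℝ} (hk : Continuous k)
    (hM : ∀ t, |k t| ≤ M) (z : ℂ) :
    Integrable fun s : ℝ => (k s : ℂ) * Complex.exp (-N * (z - s) ^ 2) := by
  refine Integrable.bdd_mul (c := M) ?_ (by fun_prop) (Eventually.of_forall fun s => ?_)
  · exact (integrable_norm_iff (by fun_prop)).1 (integrable_norm_cexp hN z)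
  · simpa using hM s

theorem integral_norm_cexp_le {N : ℝ} (hN : 0 < N) {z : ℂ} (hz : z ∈ closedStrip) :
    ∫ s : ℝ, ‖Complex.exp (-N * (z - s) ^ 2)‖ ≤
      Real.exp (N * Real.pi ^ 2) * √(Real.pi / N) := by
  simp only [norm_cexp_neg_mul_sub_sq]
  rw [integral_const_mul,
    integral_sub_right_eq_self (fun s : ℝ => Real.exp (-N * s ^ 2)) z.re, integral_gaussian]
  gcongr
  exacts [hz.1, hz.2]

theorem norm_gaussConv_le {N M : ℝ} (hN : 0 < N) {k : ℝ → ℝ} (hM : ∀ t, |k t| ≤ M) {z : ℂ}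
    (hz : z ∈ closedStrip) :
    ‖gaussConv N k z‖ ≤ M * (Real.exp (N * Real.pi ^ 2) * √(Real.pi / N)) := by
  have hM0 : 0 ≤ M := (abs_nonneg _).trans (hM 0)
  calc ‖gaussConv N k z‖ ≤ ∫ s : ℝ, M * ‖Complex.exp (-N * (z - s) ^ 2)‖ := by
        refine norm_integral_le_of_norm_le ((integrable_norm_cexp hN z).const_mul M)
          (Eventually.of_forall fun s => ?_)
        rw [norm_mul, Complex.norm_real]
        gcongr
        exact hM s
    _ ≤ _ := by
        rw [integral_const_mul]
        gcongr
        exact integral_norm_cexp_le hN hz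

theorem gaussConv_sub {N M : ℝ} (hN : 0 < N) {k l : ℝ → ℝ} (hk : Continuous k)
    (hl : Continuous l) (hkM : ∀ t, |k t| ≤ M) (hlM : ∀ t, |l t| ≤ M) (z : ℂ) :
    gaussConv N k z - gaussConv N l z = gaussConv N (fun t => k t - l t) z := by
  rw [gaussConv, gaussConv, ← integral_sub (integrable_mul_cexp hN hk hkM z)
    (integrable_mul_cexp hN hl hlM z)]
  refine integral_congr_ae (Eventually.of_forall fun s => ?_)
  push_cast
  ring

theorem gaussConv_add_ofReal (N : ℝ) (k : ℝ → ℝ) (z : ℂ) (a : ℝ) :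
    gaussConv N k (z + a) = gaussConv N (fun t => k (t + a)) z := by
  rw [gaussConv, gaussConv, ← integral_add_right_eq_self _ a]
  simp

theorem gaussConv_ofReal (N : ℝ) (k : ℝ → ℝ) (x : ℝ) :
    gaussConv N k x = ((∫ u, k (x - u) * Real.exp (-N * u ^ 2) : ℝ) : ℂ) := by
  rw [gaussConv, ← integral_sub_left_eq_self _ volume x, ← integral_complex_ofReal]
  simp

/-- Expanding the square, `gaussConv N k z` is `exp (-N z²)` times the moment generating function of
`2 * N * s` under the density `k s * exp (-N s²)`, whose exponential moments are all finite. -/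
theorem differentiable_gaussConv {N M : ℝ} (hN : 0 < N) {k : ℝ → ℝ} (hk : Continuous k)
    (hM : ∀ t, |k t| ≤ M) (hk0 : ∀ t, 0 ≤ k t) : Differentiable ℂ (gaussConv N k) := by
  set w : ℝ → NNReal := fun s => (k s * Real.exp (-N * s ^ 2)).toNNReal with hw
  have hwm : Measurable w := by fun_prop
  have hwc : ∀ s, (w s : ℝ) = k s * Real.exp (-N * s ^ 2) := fun s =>
    Real.coe_toNNReal _ (mul_nonneg (hk0 s) (Real.exp_pos _).le)
  set μ : Measure ℝ := volume.withDensity fun s => (w s : ENNReal) with hμ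
  set X : ℝ → ℝ := fun s => 2 * N * s with hX
  have hset : ProbabilityTheory.integrableExpSet X μ = univ := by
    refine eq_univ_of_forall fun t => ?_
    rw [ProbabilityTheory.integrableExpSet, mem_ofPred_eq,
      integrable_withDensity_iff_integrable_coe_smul hwm]
    have := ((integrable_exp_neg_mul_sub_sq hN t).const_mul (Real.exp (N * t ^ 2))).bdd_mul
      (c := M) hk.aestronglyMeasurable (Eventually.of_forall hM)
    refine this.congr (Eventually.of_forall fun s => ?_)
    simp only [hwc, smul_eq_mul, mul_assoc, ← Real.exp_add, hX]
    congr 2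
    ring
  have hdiff : Differentiable ℂ (ProbabilityTheory.complexMGF X μ) := by
    rw [← differentiableOn_univ]
    simpa [hset] using ProbabilityTheory.differentiableOn_complexMGF (X := X) (μ := μ)
  have heq : gaussConv N k =
      fun z => Complex.exp (-N * z ^ 2) * ProbabilityTheory.complexMGF X μ z := by
    ext z
    rw [ProbabilityTheory.complexMGF, integral_withDensity_eq_integral_smul hwm, gaussConv,
      ← integral_const_mul]
    refine integral_congr_ae (Eventually.of_forall fun s => ?_)
    simp only [NNReal.smul_def, hwc, Complex.real_smul, hX]
    push_cast
    rw [mul_assoc (k s : ℂ), ← Complex.exp_add, mul_left_comm, ← Complex.exp_add]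
    congr 2
    ring
  rw [heq]
  fun_prop

/-- A shift of the convolution is the convolution of a translate of `k`, and translates by `a`, `b`
differ by at most `φ (a - b)`. Hence a net for the gauge gives a net for the orbit. -/
theorem exists_mem_APH_eq_gaussConv {φ : ℝ → ℝ} (hφ : AlmostPeriodicGauge φ) {ε N : ℝ}
    (hε : 0 < ε) (hN : 0 < N) :
    ∃ H ∈ APH, ∀ z ∈ closedStrip, stripExtend H z = gaussConv N (gaugeBump φ ε) z := by
  set k := gaugeBump φ ε with hk
  have hkc : Continuous k := hφ.continuous_gaugeBump ε
  have hk0 : ∀ t, 0 ≤ k t := gaugeBump_nonneg φ ε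
  have hkM : ∀ t, |k t| ≤ ε := fun t => by
    rw [abs_of_nonneg (hk0 t)]; exact hφ.gaugeBump_le hε.le t
  have hd := differentiable_gaussConv hN hkc hkM hk0
  set C := Real.exp (N * Real.pi ^ 2) * √(Real.pi / N) with hC
  have hC0 : 0 < C := by have := Real.pi_pos; positivity
  set H : closedStrip →ᵇ ℂ := BoundedContinuousFunction.ofNormedAddCommGroup
    (fun z : closedStrip => gaussConv N k z) (hd.continuous.comp continuous_subtype_val)
    (ε * C) (fun z => norm_gaussConv_le hN hkM z.2) with hH
  have hHz : ∀ z ∈ closedStrip, stripExtend H z = gaussConv N k z := fun z hz =>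
    stripExtend_apply H hz
  have hdist : ∀ a b, dist (stripShift a H) (stripShift b H) ≤ C * φ (a - b) := by
    intro a b
    refine (BoundedContinuousFunction.dist_le (mul_nonneg hC0.le (hφ.nonneg _))).2 fun z => ?_
    rw [← stripExtend_apply _ z.2, ← stripExtend_apply _ z.2, stripExtend_stripShift _ _ z.2,
      stripExtend_stripShift _ _ z.2, hHz _ (add_ofReal_mem_closedStrip z.2 a),
      hHz _ (add_ofReal_mem_closedStrip z.2 b), gaussConv_add_ofReal, gaussConv_add_ofReal,
      dist_eq_norm, gaussConv_sub hN (by fun_prop) (by fun_prop) (fun t => hkM _)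
        (fun t => hkM _), mul_comm]
    refine norm_gaussConv_le hN (fun t => ?_) z.2
    simpa using hφ.abs_gaugeBump_sub_le ε (t + a) (t + b)
  refine ⟨H, ⟨?_, ?_⟩, hHz⟩
  · exact hd.differentiableOn.congr fun z hz => hHz z (interior_subset hz)
  · refine TotallyBounded.isCompact_of_isClosed (TotallyBounded.closure ?_) isClosed_closure
    rw [Metric.totallyBounded_iff]
    intro δ hδ
    obtain ⟨s, hs⟩ := hφ.exists_net (δ / C) (by positivity)
    refine ⟨(fun x => stripShift x H) '' s, s.finite_toSet.image _, ?_⟩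
    rintro _ ⟨x, rfl⟩
    obtain ⟨y, hy, hxy⟩ := hs x
    refine mem_iUnion₂.2 ⟨_, mem_image_of_mem _ hy, (hdist x y).trans_lt ?_⟩
    rwa [mul_comm, ← lt_div_iff₀ hC0]

/-- Narrow Gaussians concentrate where a gauge is small. -/
theorem AlmostPeriodicGauge.exists_gaussian {φ : ℝ → ℝ} (hφ : AlmostPeriodicGauge φ) {ε : ℝ}
    (hε : 0 < ε) : ∃ N > 0, Integrable (fun u => φ u * Real.exp (-N * u ^ 2)) ∧
      ∫ u, φ u * Real.exp (-N * u ^ 2) ≤ ε * √(Real.pi / N) := by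
  obtain ⟨B, hB⟩ := hφ.bounded
  have hB0 : 0 ≤ B := (hφ.nonneg 0).trans (hB 0)
  obtain ⟨η, hη, hη'⟩ := Metric.eventually_nhds_iff.1
    (hφ.tendsto_zero.eventually (gt_mem_nhds (half_pos hε)))
  set D := (B + 1) / η ^ 2 with hD
  have hD0 : 0 < D := by positivity
  have hpt : ∀ u, φ u ≤ ε / 2 + D * u ^ 2 := fun u => by
    by_cases hu : |u| < η
    · have : φ u < ε / 2 := hη' (by simpa using hu)
      have : 0 ≤ D * u ^ 2 := by positivity
      linarith
    · have h1 : η ^ 2 ≤ u ^ 2 := by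
        rw [← sq_abs u]; gcongr; exact not_lt.1 hu
      have h2 : B + 1 ≤ D * u ^ 2 := by
        rw [hD, div_mul_eq_mul_div, le_div_iff₀ (by positivity)]
        gcongr
      linarith [hB u]
  -- Chosen so that `D * (2 / N) = ε / 4`: the quadratic term is dominated by `ε / 4` times a
  -- Gaussian of integral at most `2 * √(π / N)`.
  set N := 8 * D / ε with hN
  have hN0 : 0 < N := by positivity
  have hint : Integrable (fun u => φ u * Real.exp (-N * u ^ 2)) :=
    (integrable_exp_neg_mul_sq hN0).bdd_mul (c := B) hφ.continuous.aestronglyMeasurable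
      (Eventually.of_forall fun u => by rw [Real.norm_of_nonneg (hφ.nonneg u)]; exact hB u)
  refine ⟨N, hN0, hint, ?_⟩
  have hle : ∀ u : ℝ, φ u * Real.exp (-N * u ^ 2) ≤
      ε / 2 * Real.exp (-N * u ^ 2) + D * (2 / N) * Real.exp (-(N / 2) * u ^ 2) := fun u => by
    have h1 : u ^ 2 * Real.exp (-N * u ^ 2) ≤ 2 / N * Real.exp (-(N / 2) * u ^ 2) := by
      have h2 : N / 2 * u ^ 2 ≤ Real.exp (N / 2 * u ^ 2) := by
        linarith [Real.add_one_le_exp (N / 2 * u ^ 2)]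
      have h3 : Real.exp (-(N / 2) * u ^ 2) =
          Real.exp (N / 2 * u ^ 2) * Real.exp (-N * u ^ 2) := by
        rw [← Real.exp_add]; congr 1; ring
      rw [h3, ← mul_assoc]
      gcongr
      rw [div_mul_eq_mul_div, le_div_iff₀ hN0]
      linarith
    calc φ u * Real.exp (-N * u ^ 2) ≤ (ε / 2 + D * u ^ 2) * Real.exp (-N * u ^ 2) := by
          gcongr; exact hpt u
      _ = ε / 2 * Real.exp (-N * u ^ 2) + D * (u ^ 2 * Real.exp (-N * u ^ 2)) := by ring
      _ ≤ _ := by rw [mul_assoc D]; gcongr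
  have hi1 := (integrable_exp_neg_mul_sq hN0).const_mul (ε / 2)
  have hi2 := (integrable_exp_neg_mul_sq (half_pos hN0)).const_mul (D * (2 / N))
  refine (integral_mono hint (hi1.add hi2) hle).trans ?_
  simp only [Pi.add_apply]
  rw [integral_add hi1 hi2, integral_const_mul, integral_const_mul, integral_gaussian,
    integral_gaussian]
  have h4 : √(Real.pi / (N / 2)) ≤ 2 * √(Real.pi / N) := by
    rw [show (2 : ℝ) = √4 by rw [show (4 : ℝ) = 2 ^ 2 by norm_num]; simp,
      ← Real.sqrt_mul (by norm_num)]
    apply Real.sqrt_le_sqrt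
    rw [show Real.pi / (N / √4) = √4 * (Real.pi / N) by field_simp]
    gcongr
    rw [show (4 : ℝ) = 2 ^ 2 by norm_num]; simp; norm_num
  have h5 : D * (2 / N) = ε / 4 := by rw [hN]; field_simp; norm_num
  rw [h5]
  nlinarith

/-- A uniform mean value persists under convolution. -/
theorem abs_integral_convolution_sub_le {k ψ : ℝ → ℝ} {M m δ L : ℝ} (hk : Continuous k)
    (hM : ∀ t, |k t| ≤ M) (hψ : Integrable ψ) (hψ0 : ∀ t, 0 ≤ ψ t)
    (hmean : ∀ y, |(∫ t in y..y + L, k t) - m * L| ≤ δ * (m * L)) (x : ℝ) :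
    |(∫ t in (0 : ℝ)..L, ∫ u, k (x - t - u) * ψ u) - (∫ u, ψ u) * (m * L)| ≤
      δ * ((∫ u, ψ u) * (m * L)) := by
  have : IsFiniteMeasure (volume.restrict (uIoc 0 L)) := ⟨by simp [uIoc]⟩
  have hint : Integrable (Function.uncurry fun t u : ℝ => k (x - t - u) * ψ u)
      ((volume.restrict (uIoc 0 L)).prod volume) := by
    refine Integrable.bdd_mul (c := M) (hψ.comp_snd _) ?_ (Eventually.of_forall fun p => hM _)
    exact (by fun_prop : Continuous fun p : ℝ × ℝ => k (x - p.1 - p.2)).aestronglyMeasurable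
  -- After Fubini each `u` sees its own window, starting at `x - L - u`; uniformity of the mean
  -- treats them all alike.
  rw [intervalIntegral_integral_swap hint]
  have hinner : ∀ u, ∫ t in (0 : ℝ)..L, k (x - t - u) * ψ u =
      (∫ t in (x - L - u)..(x - L - u) + L, k t) * ψ u := fun u => by
    rw [intervalIntegral.integral_mul_const]
    have : ∀ t, x - t - u = x - u - t := fun t => by ring
    simp only [this]
    rw [intervalIntegral.integral_comp_sub_left (fun t => k t) (x - u)]
    (congr 2; ring)
  simp only [hinner]
  have hint2 : Integrable fun u => (∫ t in (x - L - u)..(x - L - u) + L, k t) * ψ u := by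
    have hcont : Continuous fun u => ∫ t in (x - L - u)..(x - L - u) + L, k t := by
      have hp := intervalIntegral.continuous_primitive (μ := volume)
        (fun a b => hk.intervalIntegrable a b) 0
      refine Continuous.congr (f := fun u => (∫ t in (0 : ℝ)..(x - L - u) + L, k t) -
        ∫ t in (0 : ℝ)..(x - L - u), k t) ?_ fun u =>
          intervalIntegral.integral_interval_sub_left
            (hk.intervalIntegrable _ _) (hk.intervalIntegrable _ _)
      exact (hp.comp (by fun_prop)).sub (hp.comp (by fun_prop))
    refine hψ.bdd_mul (c := |m * L| + δ * (m * L)) hcont.aestronglyMeasurable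
      (Eventually.of_forall fun u => ?_)
    rw [Real.norm_eq_abs]
    have := abs_add_le (m * L) ((∫ t in (x - L - u)..(x - L - u) + L, k t) - m * L)
    rw [add_sub_cancel] at this
    linarith [hmean (x - L - u)]
  rw [← integral_mul_const, ← integral_sub hint2 (hψ.mul_const _), ← integral_const_mul,
    ← Real.norm_eq_abs]
  refine norm_integral_le_of_norm_le ((hψ.mul_const _).const_mul _)
    (Eventually.of_forall fun u => ?_)
  rw [mul_comm (ψ u), ← sub_mul, norm_mul, Real.norm_of_nonneg (hψ0 u), ← mul_assoc]
  exact mul_le_mul_of_nonneg_right (hmean _) (hψ0 u)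

/-! ### The almost periodic kernel -/

/-- Existence of almost periodic kernels, positive on the real line, with a uniform mean value,
and concentrated where the gauge is small. -/
theorem AlmostPeriodicGauge.exists_kernel {φ : ℝ → ℝ} (hφ : AlmostPeriodicGauge φ) {ε : ℝ}
    (hε : 0 < ε) : ∃ H ∈ APH, ∃ h : ℝ → ℝ, Continuous h ∧ (∀ t, 0 ≤ h t) ∧
      (∀ x : ℝ, stripExtend H x = h x) ∧ ∃ c > 0, ∃ L₀ > 0, ∀ L ≥ L₀, ∃ m ≥ c, ∀ x,
        |(∫ t in (0 : ℝ)..L, h (x - t)) - m * L| ≤ ε * (m * L) ∧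
        ∫ t in (0 : ℝ)..L, h (x - t) * φ (x - t) ≤ ε * (m * L) := by
  have hε4 : 0 < ε / 4 := by positivity
  set k := gaugeBump φ (ε / 4) with hk
  have hkc : Continuous k := hφ.continuous_gaugeBump _
  have hk0 : ∀ t, 0 ≤ k t := gaugeBump_nonneg φ _
  have hkM : ∀ t, |k t| ≤ ε / 4 := fun t => by
    rw [abs_of_nonneg (hk0 t)]; exact hφ.gaugeBump_le hε4.le t
  obtain ⟨N, hN, hφint, hφN⟩ := hφ.exists_gaussian hε4
  obtain ⟨H, hH, hHz⟩ := exists_mem_APH_eq_gaussConv hφ hε4 hN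
  obtain ⟨c, hc, hmean⟩ := hφ.exists_mean hε4
  -- A relative error at most `1` bounds integrals by twice the expected value, whence the choice of
  -- `ε / 4` above.
  obtain ⟨L₀, hL₀, hmean⟩ := hmean (min ε 1) (by positivity)
  have hgint := integrable_exp_neg_mul_sq hN
  set Γ := √(Real.pi / N) with hΓ
  have hΓ0 : 0 < Γ := by have := Real.pi_pos; positivity
  set h : ℝ → ℝ := fun x => ∫ u, k (x - u) * Real.exp (-N * u ^ 2) with hh
  set q : ℝ → ℝ := fun x => ∫ u, k (x - u) * (φ u * Real.exp (-N * u ^ 2)) with hq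
  have hHh : ∀ x : ℝ, stripExtend H x = h x := fun x => by
    rw [hHz _ (ofReal_mem_closedStrip x), gaussConv_ofReal]
  have hconv : ∀ ψ : ℝ → ℝ, Integrable ψ → Continuous fun x => ∫ u, k (x - u) * ψ u := by
    intro ψ hψ
    refine continuous_of_dominated (F := fun x u => k (x - u) * ψ u)
      (bound := fun u => ε / 4 * ‖ψ u‖) (fun x => ?_)
      (fun x => Eventually.of_forall fun u => ?_) (hψ.norm.const_mul _)
      (Eventually.of_forall fun u => by fun_prop)
    · exact (by fun_prop : Continuous fun u => k (x - u)).aestronglyMeasurable.mul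
        hψ.aestronglyMeasurable
    · rw [norm_mul]
      gcongr
      exact hkM _
  have hki : ∀ ψ : ℝ → ℝ, Integrable ψ → ∀ x, Integrable fun u => k (x - u) * ψ u :=
    fun ψ hψ x => hψ.bdd_mul (c := ε / 4)
      (by fun_prop : Continuous fun u => k (x - u)).aestronglyMeasurable
      (Eventually.of_forall fun u => hkM _)
  have hhc : Continuous h := hconv _ hgint
  have hqc : Continuous q := hconv _ hφint
  -- By `φ x ≤ φ (x - u) + φ u`, the first term is small on the support of the bump and the second
  -- under the Gaussian.
  have hhφ : ∀ x, h x * φ x ≤ ε / 4 * h x + q x := fun x => by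
    rw [hh, hq]
    simp only
    rw [← integral_mul_const, ← integral_const_mul, ← integral_add
      ((hki _ hgint x).const_mul _) (hki _ hφint x)]
    refine integral_mono ((hki _ hgint x).mul_const _)
      (((hki _ hgint x).const_mul _).add (hki _ hφint x)) fun u => ?_
    have h1 : φ x ≤ φ (x - u) + φ u := by simpa using hφ.add_le (x - u) u
    have h2 := gaugeBump_mul_le φ (ε / 4) (x - u)
    have h3 : k (x - u) * φ x ≤ ε / 4 * k (x - u) + k (x - u) * φ u :=
      (mul_le_mul_of_nonneg_left h1 (hk0 _)).trans (by linarith)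
    have := mul_le_mul_of_nonneg_right h3 (Real.exp_pos (-N * u ^ 2)).le
    simp only
    linarith
  refine ⟨H, hH, h, hhc, fun t => integral_nonneg fun u => mul_nonneg (hk0 _) (Real.exp_pos _).le,
    hHh, Γ * c, by positivity, L₀, hL₀, fun L hL => ?_⟩
  obtain ⟨m, hm, hmL⟩ := hmean L hL
  have hLpos : 0 < L := hL₀.trans_le hL
  have hmpos : 0 < m := hc.trans_le hm
  refine ⟨Γ * m, by gcongr, fun x => ?_⟩
  have h1 := abs_integral_convolution_sub_le hkc hkM hgint (fun u => (Real.exp_pos _).le) hmL x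
  have h2 := abs_integral_convolution_sub_le hkc hkM hφint
    (fun u => mul_nonneg (hφ.nonneg u) (Real.exp_pos _).le) hmL x
  rw [integral_gaussian, ← mul_assoc, ← hΓ] at h1
  have hP : 0 < Γ * m * L := by positivity
  have hδ1 : min ε 1 * (Γ * m * L) ≤ 1 * (Γ * m * L) := by gcongr; exact min_le_right _ _
  have hδε : min ε 1 * (Γ * m * L) ≤ ε * (Γ * m * L) := by gcongr; exact min_le_left _ _
  refine ⟨h1.trans hδε, ?_⟩
  have h3 : ∫ t in (0 : ℝ)..L, h (x - t) * φ (x - t) ≤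
      ∫ t in (0 : ℝ)..L, (ε / 4 * h (x - t) + q (x - t)) := by
    have := hφ.continuous
    exact intervalIntegral.integral_mono_on hLpos.le
      (Continuous.intervalIntegrable (by fun_prop) _ _)
      (Continuous.intervalIntegrable (by fun_prop) _ _) fun t _ => hhφ _
  rw [intervalIntegral.integral_add (Continuous.intervalIntegrable (by fun_prop) _ _)
    (Continuous.intervalIntegrable (by fun_prop) _ _), intervalIntegral.integral_const_mul] at h3
  have h4 : ∫ t in (0 : ℝ)..L, h (x - t) ≤ 2 * (Γ * m * L) := by
    have := (abs_le.1 h1).2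
    simp only [hh]
    linarith
  have hJ : (∫ u, φ u * Real.exp (-N * u ^ 2)) * (m * L) ≤ ε / 4 * (Γ * m * L) := by
    calc _ ≤ ε / 4 * Γ * (m * L) := by gcongr
      _ = _ := by ring
  have hJ0 : 0 ≤ (∫ u, φ u * Real.exp (-N * u ^ 2)) * (m * L) := by
    have : 0 ≤ ∫ u, φ u * Real.exp (-N * u ^ 2) :=
      integral_nonneg fun u => mul_nonneg (hφ.nonneg u) (Real.exp_pos _).le
    positivity
  have h5 : ∫ t in (0 : ℝ)..L, q (x - t) ≤ 2 * (ε / 4 * (Γ * m * L)) := by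
    have h6 := (abs_le.1 h2).2
    have h7 : min ε 1 * ((∫ u, φ u * Real.exp (-N * u ^ 2)) * (m * L)) ≤
      1 * ((∫ u, φ u * Real.exp (-N * u ^ 2)) * (m * L)) := by gcongr; exact min_le_right _ _
    simp only [hq]
    linarith
  have h8 : ε / 4 * ∫ t in (0 : ℝ)..L, h (x - t) ≤ ε / 4 * (2 * (Γ * m * L)) := by gcongr
  linarith

/-! ### Convolution operators and finite rank -/

theorem stripShift_mem_APH {f : closedStrip →ᵇ ℂ} (hf : f ∈ APH) (x : ℝ) :
    stripShift x f ∈ APH := by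
  have hmaps : MapsTo (fun z : ℂ => z + x) (interior closedStrip) (interior closedStrip) := by
    intro z hz
    simpa [interior_closedStrip] using hz
  refine ⟨?_, hf.2.closure_of_subset ?_⟩
  · exact (DifferentiableOn.comp (t := interior closedStrip) hf.1 (by fun_prop) hmaps).congr
      fun z hz => stripExtend_stripShift x f (interior_subset hz)
  · rintro _ ⟨y, rfl⟩
    exact subset_closure ⟨y + x, stripShift_add y x f⟩

theorem continuous_stripExtend_ofReal (f : closedStrip →ᵇ ℂ) :
    Continuous fun t : ℝ => stripExtend f t :=
  continuous_stripExtend_comp Complex.continuous_ofReal ofReal_mem_closedStrip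

theorem continuous_stripExtend_sub (f : closedStrip →ᵇ ℂ) {z : ℂ} (hz : z ∈ closedStrip) :
    Continuous fun t : ℝ => stripExtend f (z - t) :=
  continuous_stripExtend_comp (by fun_prop) fun t => sub_ofReal_mem_closedStrip hz t

/-- Integration over a real interval as a bounded functional on `APH`. -/
noncomputable def APH.intervalIntegralCLM (a b : ℝ) : APH →L[ℂ] ℂ :=
  LinearMap.mkContinuous
    { toFun := fun f => ∫ t in a..b, stripExtend (f : closedStrip →ᵇ ℂ) t
      map_add' := fun f g => by
        rw [← intervalIntegral.integral_add
          ((continuous_stripExtend_ofReal _).intervalIntegrable _ _)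
          ((continuous_stripExtend_ofReal _).intervalIntegrable _ _)]
        simp [stripExtend_apply _ (ofReal_mem_closedStrip _)]
      map_smul' := fun c f => by
        rw [RingHom.id_apply, smul_eq_mul, ← intervalIntegral.integral_const_mul]
        simp [stripExtend_apply _ (ofReal_mem_closedStrip _)] }
    |b - a| fun f => by
      rw [mul_comm]
      exact intervalIntegral.norm_integral_le_of_norm_le_const fun t _ => norm_stripExtend_le _ _

theorem APH.intervalIntegralCLM_apply (a b : ℝ) (f : APH) :
    APH.intervalIntegralCLM a b f = ∫ t in a..b, stripExtend (f : closedStrip →ᵇ ℂ) t := rfl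

/-- Convolutions over a bounded interval are approximated in norm by operators of finite rank. -/
theorem exists_finiteRank_approx_convolution {H : closedStrip →ᵇ ℂ} (hH : H ∈ APH) {L ω : ℝ}
    (hL : 0 < L) (hω : 0 < ω) :
    ∃ T : APH →L[ℂ] APH, FiniteDimensional ℂ (LinearMap.range (T : APH →ₗ[ℂ] APH)) ∧
      ∀ (f : APH), ∀ z ∈ closedStrip, ‖stripExtend (T f : closedStrip →ᵇ ℂ) z -
        ∫ t in (0 : ℝ)..L, stripExtend (f : closedStrip →ᵇ ℂ) t * stripExtend H (z - t)‖ ≤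
          ω * ‖f‖ := by
  obtain ⟨η, hη, hη'⟩ := Metric.eventually_nhds_iff.1
    (Metric.tendsto_nhds.1 (tendsto_stripShift_zero hH.2) (ω / L) (by positivity))
  obtain ⟨n, hn⟩ := exists_nat_gt (L / η)
  have hn0 : (0 : ℝ) < n := lt_trans (by positivity) hn
  have hstep : L / n < η := by rwa [div_lt_iff₀ hn0, mul_comm, ← div_lt_iff₀ hη]
  set a : ℕ → ℝ := fun j => j * (L / n) with ha
  have ha1 : ∀ j, a (j + 1) - a j = L / n := fun j => by simp only [ha]; push_cast; ring
  -- On `[a j, a (j + 1)]` only the kernel is frozen, at `t = a j`; `f` is integrated exactly, so no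
  -- modulus of continuity of `f` enters.
  set S : ℕ → APH := fun j => ⟨stripShift (-a j) H, stripShift_mem_APH hH _⟩ with hS
  set T : APH →L[ℂ] APH :=
    ∑ j ∈ Finset.range n, (APH.intervalIntegralCLM (a j) (a (j + 1))).smulRight (S j) with hT
  have hTf : ∀ f, T f = ∑ j ∈ Finset.range n,
      (∫ t in a j..a (j + 1), stripExtend (f : closedStrip →ᵇ ℂ) t) • S j := fun f => by
    simp [hT, APH.intervalIntegralCLM_apply]
  refine ⟨T, ?_, fun f z hz => ?_⟩
  · have : LinearMap.range (T : APH →ₗ[ℂ] APH) ≤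
        Submodule.span ℂ (S '' Finset.range n) := by
      rintro _ ⟨f, rfl⟩
      rw [ContinuousLinearMap.coe_coe, hTf]
      exact Submodule.sum_mem _ fun j hj => Submodule.smul_mem _ _
        (Submodule.subset_span (mem_image_of_mem S hj))
    have hspan := FiniteDimensional.span_of_finite ℂ ((Finset.range n).finite_toSet.image S)
    exact Submodule.finiteDimensional_of_le this
  · have hfc := continuous_stripExtend_ofReal (f : closedStrip →ᵇ ℂ)
    have hHc := continuous_stripExtend_sub H hz
    have hval : stripExtend (T f : closedStrip →ᵇ ℂ) z = ∑ j ∈ Finset.range n,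
        ∫ t in a j..a (j + 1), stripExtend (f : closedStrip →ᵇ ℂ) t *
          stripExtend H (z - (a j : ℝ)) := by
      rw [hTf, stripExtend_apply _ hz]
      simp only [Submodule.coe_sum, Submodule.coe_smul, BoundedContinuousFunction.coe_sum,
        Finset.sum_apply, BoundedContinuousFunction.coe_smul, smul_eq_mul,
        intervalIntegral.integral_mul_const, hS]
      refine Finset.sum_congr rfl fun j _ => ?_
      rw [← stripExtend_apply _ hz, stripExtend_stripShift _ _ hz]
      push_cast
      rw [sub_eq_add_neg]
    have hsplit : ∫ t in (0 : ℝ)..L, stripExtend (f : closedStrip →ᵇ ℂ) t *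
        stripExtend H (z - t) = ∑ j ∈ Finset.range n, ∫ t in a j..a (j + 1),
          stripExtend (f : closedStrip →ᵇ ℂ) t * stripExtend H (z - t) := by
      rw [intervalIntegral.sum_integral_adjacent_intervals fun j _ =>
        Continuous.intervalIntegrable (by fun_prop) _ _]
      simp only [ha]
      rw [Nat.cast_zero, zero_mul, mul_div_cancel₀ _ hn0.ne']
    rw [hval, hsplit, ← Finset.sum_sub_distrib]
    have hterm : ∀ j ∈ Finset.range n, ‖(∫ t in a j..a (j + 1),
        stripExtend (f : closedStrip →ᵇ ℂ) t * stripExtend H (z - (a j : ℝ))) -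
        ∫ t in a j..a (j + 1), stripExtend (f : closedStrip →ᵇ ℂ) t * stripExtend H (z - t)‖ ≤
        ‖f‖ * (ω / L) * (L / n) := by
      intro j _
      rw [← intervalIntegral.integral_sub (Continuous.intervalIntegrable (by fun_prop) _ _)
        (Continuous.intervalIntegrable (by fun_prop) _ _)]
      have hLn : 0 ≤ L / n := by positivity
      have := intervalIntegral.norm_integral_le_of_norm_le_const (a := a j) (b := a (j + 1))
        (C := ‖f‖ * (ω / L)) (f := fun t : ℝ => stripExtend (f : closedStrip →ᵇ ℂ) t *
          stripExtend H (z - (a j : ℝ)) - stripExtend (f : closedStrip →ᵇ ℂ) t *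
          stripExtend H (z - t)) fun t ht => by
        have hat := ha1 j
        rw [uIoc_of_le (by linarith)] at ht
        rw [← mul_sub, norm_mul]
        gcongr
        · exact norm_stripExtend_le _ _
        · have h1 := norm_stripExtend_add_sub_le H (a j - t)
            (sub_ofReal_mem_closedStrip hz (a j))
          have h2 : z - (a j : ℝ) + ((a j - t : ℝ) : ℂ) = z - t := by push_cast; ring
          rw [h2, norm_sub_rev] at h1
          refine h1.trans (hη' ?_).le
          rw [Real.dist_eq, sub_zero, abs_sub_lt_iff]
          constructor <;> linarith [ht.1, ht.2]
      rwa [ha1, abs_of_nonneg hLn] at this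
    refine (norm_sum_le_of_le _ hterm).trans (le_of_eq ?_)
    rw [Finset.sum_const, Finset.card_range, nsmul_eq_mul]
    generalize ‖f‖ = b
    have hn1 := hn0.ne'
    field_simp

/-! ### Contractivity and approximation -/

/-- Averages against a nonnegative kernel with mean close to `m`. -/
theorem norm_integral_mul_kernel_le {u : ℝ → ℂ} {h φ : ℝ → ℝ} {A m δ L x : ℝ}
    (hu : Continuous u) (hh : Continuous h) (hφ : Continuous φ) (hA : ∀ t, ‖u t‖ ≤ A)
    (hL : 0 ≤ L) (hh0 : ∀ t, 0 ≤ h t)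
    (h1 : |(∫ t in (0 : ℝ)..L, h (x - t)) - m * L| ≤ δ * (m * L)) :
    ‖∫ t in (0 : ℝ)..L, u t * h (x - t)‖ ≤ (1 + δ) * (m * L) * A ∧
      (∫ t in (0 : ℝ)..L, h (x - t) * φ (x - t) ≤ δ * (m * L) →
        (∀ t, ‖u t - u x‖ ≤ φ (x - t)) →
        ‖(∫ t in (0 : ℝ)..L, u t * h (x - t)) - (m * L : ℝ) * u x‖ ≤ δ * (m * L) * (A + 1)) := by
  have hA0 : 0 ≤ A := (norm_nonneg _).trans (hA 0)
  have hhc : Continuous fun t => h (x - t) := by fun_prop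
  constructor
  · have h2 : ‖∫ t in (0 : ℝ)..L, u t * h (x - t)‖ ≤ ∫ t in (0 : ℝ)..L, A * h (x - t) := by
      refine intervalIntegral.norm_integral_le_of_norm_le hL (Eventually.of_forall fun t _ => ?_)
        (Continuous.intervalIntegrable (by fun_prop) _ _)
      rw [norm_mul, Complex.norm_real, Real.norm_of_nonneg (hh0 _)]
      exact mul_le_mul_of_nonneg_right (hA t) (hh0 _)
    rw [intervalIntegral.integral_const_mul, mul_comm] at h2
    refine h2.trans (mul_le_mul_of_nonneg_right ?_ hA0)
    linarith [(abs_le.1 h1).2]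
  · intro hsmall hux
    have hsplit : (∫ t in (0 : ℝ)..L, u t * h (x - t)) - (m * L : ℝ) * u x =
        (∫ t in (0 : ℝ)..L, (u t - u x) * h (x - t)) +
          ((∫ t in (0 : ℝ)..L, h (x - t)) - m * L : ℝ) * u x := by
      simp only [sub_mul]
      rw [intervalIntegral.integral_sub (Continuous.intervalIntegrable (by fun_prop) _ _)
        (Continuous.intervalIntegrable (by fun_prop) _ _), intervalIntegral.integral_const_mul,
        intervalIntegral.integral_ofReal]
      push_cast
      ring
    have h2 : ‖∫ t in (0 : ℝ)..L, (u t - u x) * h (x - t)‖ ≤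
        ∫ t in (0 : ℝ)..L, h (x - t) * φ (x - t) := by
      refine intervalIntegral.norm_integral_le_of_norm_le hL (Eventually.of_forall fun t _ => ?_)
        (Continuous.intervalIntegrable (by fun_prop) _ _)
      rw [norm_mul, Complex.norm_real, Real.norm_of_nonneg (hh0 _), mul_comm]
      exact mul_le_mul_of_nonneg_left (hux t) (hh0 _)
    have h3 : ‖(((∫ t in (0 : ℝ)..L, h (x - t)) - m * L : ℝ) : ℂ) * u x‖ ≤ δ * (m * L) * A := by
      rw [norm_mul, Complex.norm_real]
      exact mul_le_mul h1 (hA x) (norm_nonneg _) ((abs_nonneg _).trans h1)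
    rw [hsplit]
    refine (norm_add_le _ _).trans ?_
    linarith

/-- Finite families in `APH` are approximated by contractions of finite rank. -/
theorem exists_finiteRank_contraction {ι : Type*} [Fintype ι] (F : ι → APH) {ε : ℝ}
    (hε : 0 < ε) : ∃ T : APH →L[ℂ] APH,
      FiniteDimensional ℂ (LinearMap.range (T : APH →ₗ[ℂ] APH)) ∧ ‖T‖ ≤ 1 ∧
        ∀ i, ‖T (F i) - F i‖ ≤ ε := by
  set F' : ι → closedStrip →ᵇ ℂ := fun i => F i with hF'
  have hφ := almostPeriodicGauge_shiftDist (F := F') fun i => (F i).2.2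
  set φ := shiftDist F' with hφdef
  set M : ℝ := ∑ i, ‖F i‖ with hM
  have hM0 : 0 ≤ M := Finset.sum_nonneg fun i _ => norm_nonneg _
  have hFM : ∀ i, ‖F i‖ ≤ M := fun i =>
    Finset.single_le_sum (f := fun i => ‖F i‖) (fun _ _ => norm_nonneg _) (Finset.mem_univ i)
  -- The final error is `δ * P * (3 * M + 1)` from the convolution plus `3 * δ * P * M` from
  -- normalizing by `Q` instead of `P`.
  set δ := ε / (6 * M + 1) with hδ
  have hδ0 : 0 < δ := by positivity
  obtain ⟨H, hH, h, hhc, hh0, hHh, c, hc, L₀, hL₀, hker⟩ := hφ.exists_kernel hδ0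
  -- With `m ≥ c` this makes the vertical sides of the contour at most `δ * P * ‖f‖`.
  set L := max L₀ (2 * Real.pi * ‖H‖ / (δ * c)) with hLdef
  have hL : 0 < L := hL₀.trans_le (le_max_left _ _)
  obtain ⟨m, hm, hker⟩ := hker L (le_max_left _ _)
  have hm0 : 0 < m := hc.trans_le hm
  set P := m * L with hP
  have hP0 : 0 < P := by positivity
  have hHP : 2 * Real.pi * ‖H‖ ≤ δ * P := by
    have h1 : 2 * Real.pi * ‖H‖ / (δ * c) ≤ L := le_max_right _ _
    rw [div_le_iff₀ (by positivity)] at h1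
    have h2 : δ * (c * L) ≤ δ * (m * L) := by gcongr
    linarith
  obtain ⟨T, hTfin, hT⟩ := exists_finiteRank_approx_convolution hH hL (ω := δ * P) (by positivity)
  have hbot : ∀ (f : APH) (x : ℝ), ‖stripExtend (T f : closedStrip →ᵇ ℂ) x -
      ∫ t in (0 : ℝ)..L, stripExtend (f : closedStrip →ᵇ ℂ) t * h (x - t)‖ ≤
        2 * (δ * P) * ‖f‖ := fun f x => by
    have h1 := hT f x (ofReal_mem_closedStrip x)
    simp only [← Complex.ofReal_sub, hHh] at h1
    have : 0 ≤ δ * P * ‖f‖ := by positivity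
    linarith
  -- One `δ * P * ‖f‖` comes from discretization, the other from the contour shift.
  have htop : ∀ (f : APH) (x : ℝ), ‖stripExtend (T f : closedStrip →ᵇ ℂ)
      (x + Real.pi * Complex.I) - ∫ t in (0 : ℝ)..L, stripExtend (f : closedStrip →ᵇ ℂ)
        (t + Real.pi * Complex.I) * h (x - t)‖ ≤ 2 * (δ * P) * ‖f‖ := fun f x => by
    have h1 := hT f _ (ofReal_add_pi_mem_closedStrip x)
    have h2 := norm_integral_convolution_sub_le f.2.1 hH.1 x L
    simp only [hHh] at h2
    have h3 : 2 * Real.pi * (‖(f : closedStrip →ᵇ ℂ)‖ * ‖H‖) ≤ δ * P * ‖f‖ := by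
      have := mul_le_mul_of_nonneg_right hHP (norm_nonneg f)
      rw [Submodule.coe_norm]
      rw [Submodule.coe_norm] at this
      linarith
    refine (norm_sub_le_norm_sub_add_norm_sub _ _ _).trans ((add_le_add h1 (h2.trans h3)).trans ?_)
    linarith
  have hcbot : ∀ f : APH, Continuous fun t : ℝ => stripExtend (f : closedStrip →ᵇ ℂ) t :=
    fun f => continuous_stripExtend_ofReal _
  have hctop : ∀ f : APH, Continuous fun t : ℝ =>
      stripExtend (f : closedStrip →ᵇ ℂ) (t + Real.pi * Complex.I) :=
    fun f => continuous_stripExtend_comp (by fun_prop) ofReal_add_pi_mem_closedStrip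
  have hnorm : ∀ f : APH, ‖T f‖ ≤ (1 + 3 * δ) * P * ‖f‖ := by
    intro f
    refine norm_le_of_boundary_le (T f).2.1 (fun x => ?_) fun x => ?_
    · have h1 := hbot f x
      have h2 := (norm_integral_mul_kernel_le (hcbot f) hhc hφ.continuous
        (fun t => norm_stripExtend_le _ _) hL.le hh0 (hker x).1).1
      have h3 := norm_le_norm_add_norm_sub' (stripExtend (T f : closedStrip →ᵇ ℂ) x)
        (∫ t in (0 : ℝ)..L, stripExtend (f : closedStrip →ᵇ ℂ) t * h (x - t))
      rw [Submodule.coe_norm] at *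
      linarith
    · have h1 := htop f x
      have h2 := (norm_integral_mul_kernel_le (hctop f) hhc hφ.continuous
        (fun t => norm_stripExtend_le _ _) hL.le hh0 (hker x).1).1
      have h3 := norm_le_norm_add_norm_sub'
        (stripExtend (T f : closedStrip →ᵇ ℂ) (x + Real.pi * Complex.I))
        (∫ t in (0 : ℝ)..L, stripExtend (f : closedStrip →ᵇ ℂ) (t + Real.pi * Complex.I) *
          h (x - t))
      rw [Submodule.coe_norm] at *
      linarith
  have happrox : ∀ i, ‖T (F i) - (P : ℂ) • F i‖ ≤ δ * P * (3 * M + 1) := by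
    intro i
    have hext : ∀ z ∈ closedStrip,
        stripExtend ((T (F i) - (P : ℂ) • F i : APH) : closedStrip →ᵇ ℂ) z =
          stripExtend (T (F i) : closedStrip →ᵇ ℂ) z -
            P * stripExtend (F i : closedStrip →ᵇ ℂ) z := fun z hz => by
      simp [stripExtend_apply _ hz]
    have hFi : δ * P * ‖F i‖ ≤ δ * P * M := by gcongr; exact hFM i
    have hosc : ∀ (x t : ℝ) (z : ℂ), z ∈ closedStrip →
        ‖stripExtend (F i : closedStrip →ᵇ ℂ) (z + (t - x : ℝ)) -
          stripExtend (F i : closedStrip →ᵇ ℂ) z‖ ≤ φ (x - t) := fun x t z hz => by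
      have := norm_stripExtend_sub_le_shiftDist F' i (t - x) hz
      rwa [← hφdef, ← hφ.neg, neg_sub] at this
    refine norm_le_of_boundary_le (T (F i) - (P : ℂ) • F i).2.1 (fun x => ?_) fun x => ?_
    · rw [hext _ (ofReal_mem_closedStrip x)]
      have h1 := hbot (F i) x
      have h2 := (norm_integral_mul_kernel_le (hcbot (F i)) hhc hφ.continuous
        (fun t => norm_stripExtend_le _ _) hL.le hh0 (hker x).1).2 (hker x).2 fun t => by
          have := hosc x t x (ofReal_mem_closedStrip x)
          rwa [← Complex.ofReal_add, add_sub_cancel] at this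
      refine (norm_sub_le_norm_sub_add_norm_sub _ _ _).trans ((add_le_add h1 h2).trans ?_)
      rw [Submodule.coe_norm] at *
      linarith
    · rw [hext _ (ofReal_add_pi_mem_closedStrip x)]
      have h1 := htop (F i) x
      have h2 := (norm_integral_mul_kernel_le (hctop (F i)) hhc hφ.continuous
        (fun t => norm_stripExtend_le _ _) hL.le hh0 (hker x).1).2 (hker x).2 fun t => by
          have := hosc x t _ (ofReal_add_pi_mem_closedStrip x)
          rwa [add_right_comm, ← Complex.ofReal_add, add_sub_cancel] at this
      refine (norm_sub_le_norm_sub_add_norm_sub _ _ _).trans ((add_le_add h1 h2).trans ?_)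
      rw [Submodule.coe_norm] at *
      linarith
  -- Dividing by the norm bound rather than by the mass `P` makes the norm at most exactly one.
  set Q := (1 + 3 * δ) * P with hQ
  have hQ0 : 0 < Q := by positivity
  have hQn : ‖((Q : ℂ))⁻¹‖ = Q⁻¹ := by
    rw [norm_inv, Complex.norm_real, Real.norm_of_nonneg hQ0.le]
  refine ⟨(Q : ℂ)⁻¹ • T, ?_, ?_, fun i => ?_⟩
  · refine Submodule.finiteDimensional_of_le (S₂ := LinearMap.range (T : APH →ₗ[ℂ] APH)) ?_
    rintro _ ⟨f, rfl⟩
    exact ⟨(Q : ℂ)⁻¹ • f, by simp⟩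
  · refine ContinuousLinearMap.opNorm_le_bound _ zero_le_one fun f => ?_
    rw [smul_apply, norm_smul, hQn, one_mul, inv_mul_le_iff₀ hQ0]
    exact hnorm f
  · have hQc : (Q : ℂ) ≠ 0 := by exact_mod_cast hQ0.ne'
    have h1 : ((Q : ℂ)⁻¹ • T) (F i) - F i =
        (Q : ℂ)⁻¹ • ((T (F i) - (P : ℂ) • F i) - ((3 * δ * P : ℝ) : ℂ) • F i) := by
      rw [smul_apply, sub_sub, ← add_smul, ← Complex.ofReal_add,
        show P + 3 * δ * P = Q by rw [hQ]; ring, smul_sub, inv_smul_smul₀ hQc]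
    have h2 : ‖((3 * δ * P : ℝ) : ℂ) • F i‖ ≤ 3 * δ * P * M := by
      rw [norm_smul, Complex.norm_real, Real.norm_of_nonneg (by positivity)]
      gcongr
      exact hFM i
    rw [h1, norm_smul, hQn, inv_mul_le_iff₀ hQ0]
    refine (norm_sub_le _ _).trans ((add_le_add (happrox i) h2).trans ?_)
    have h3 : δ * (6 * M + 1) = ε := div_mul_cancel₀ _ (by positivity)
    have h4 : P * ε ≤ Q * ε := by
      gcongr
      rw [hQ]
      nlinarith
    calc _ = P * (δ * (6 * M + 1)) := by ring
      _ ≤ Q * ε := by rw [h3]; exact h4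

/-- An `ε / 3`-net of `K` suffices: since `T` is a contraction, replacing `f` by a net point `g`
changes `T f - f` by at most `2 * ‖f - g‖`. -/
theorem proposition3p1 : HasMetricApproximationProperty APH := by
  intro K hK ε hε
  obtain ⟨s, -, hs, hcov⟩ := hK.finite_cover_balls (show 0 < ε / 3 by positivity)
  have := hs.fintype
  obtain ⟨T, hfin, hT, happrox⟩ := exists_finiteRank_contraction (fun i : s => (i : APH))
    (show 0 < ε / 3 by positivity)
  refine ⟨T, hfin, hT, fun f hf => ?_⟩
  obtain ⟨g, hg, hfg⟩ := mem_iUnion₂.1 (hcov hf)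
  rw [mem_ball_iff_norm] at hfg
  have h1 : ‖T (f - g)‖ ≤ ‖f - g‖ := T.le_of_opNorm_le hT _ |>.trans (one_mul _).le
  have h2 := happrox ⟨g, hg⟩
  have h3 : T f - f = T (f - g) + (T g - g) - (f - g) := by rw [map_sub]; abel
  rw [h3]
  refine (norm_sub_le _ _).trans ?_
  have := norm_add_le (T (f - g)) (T g - g)
  simp only at h2
  linarith
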